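/- All graphs are finite and simple. For a real square matrix $M=[a_{ij}]_{m\times m}$ let $\mathrm{per}(M)=\sum_{\sigma}\prod_{i=1}^m a_{i\sigma(i)}$, the sum over all permutations $\sigma$ of $\{1,\dots,m\}$. The permanent index $\mathrm{pind}(M)$ of a real matrix $M$ is the least integer $k\ge 0$ for which there is a square matrix $M'$ with $\mathrm{per}(M')\neq 0$, each column of which is a column of $M$, and in which each (indexed) column of $M$ is used at most $k$ times ($\mathrm{pind}(M)=\infty$ if no such $k$ exists). For a graph $G$ with an orientation of its edges, let $B_G$ be the matrix with rows and columns indexed by $E(G)$ such that, for an edge $e$ oriented from $u$ to $v$, $B_G[e,y]=1$ if $y\ne e$ is incident to $v$, $B_G[e,y]=-1$ if $y\neq e$ is incident to $u$, and $B_G[e,y]=0$ otherwise. The graph $G$ is $(k,k')$-choosable if, for every assignment $L$ of a set of $k$ real numbers to each vertex and a set of $k'$ real numbers to each edge, there is $f:V(G)\cup E(G)\to\mathbb{R}$ with $f(z)\in L(z)$ for all $z$ and $$f(u)+\sum_{e\ni u}f(e)\neq f(v)+\sum_{e\ni v}f(e)$$ for all adjacent $u,v$. A bicyclic graph is a connected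 graph with $n$ vertices and $m=n+1$ edges (such a graph contains two or three cycles). **Theorem.** For every bicyclic graph $B$ and every orientation of its edges, $\mathrm{pind}(B_B)\le 2$. Hence every connected graph with $m=n+1$ is $(1,3)$-choosable. -/

import Mathlib

/-- The property defining the permanent index: there is a square matrix `A'` with nonzero
permanent, each of whose columns is a column of `A` (column `i` of `A'` is column `f i` of `A`),
such that each column of `A` is used at most `k` times. -/
def Matrix.HasNonzeroPermSelection {m n : Type*} [Fintype m] [DecidableEq m] [DecidableEq n]
    (A : Matrix m n ℝ) (k : ℕ) : Prop :=
  ∃ f : m → n, (∀ j : n, (Finset.univ.filter fun i : m => f i = j).card ≤ k) ∧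
    (A.submatrix id f).permanent ≠ 0

/-- The permanent index of `A`: the least `k` such that some square matrix formed from columns of
`A`, each used at most `k` times, has nonzero permanent; it is `⊤` if there is no such `k`. -/
noncomputable def Matrix.pind {m n : Type*} [Fintype m] [DecidableEq m] [DecidableEq n]
    (A : Matrix m n ℝ) : ℕ∞ :=
  ⨅ (k : ℕ) (_ : A.HasNonzeroPermSelection k), (k : ℕ∞)

namespace SimpleGraph

variable {V : Type*}

/-- An orientation of `G`: every edge gets a tail and a head, which are its two endpoints. -/
structure EdgeOrientation (G : SimpleGraph V) where
  tail : G.edgeSet → V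
  head : G.edgeSet → V
  mk_tail_head : ∀ e : G.edgeSet, s(tail e, head e) = (e : Sym2 V)

/-- The condition on a column `y` (a vertex or an edge) in row `e`: either `y` is the vertex
`v`, or `y ≠ e` is an edge incident to `v`. -/
def Touches {G : SimpleGraph V} (e : G.edgeSet) (v : V) : V ⊕ G.edgeSet → Prop
  | Sum.inl w => w = v
  | Sum.inr y => y ≠ e ∧ v ∈ (y : Sym2 V)

open Classical in
/-- The matrix `A_G`, rows indexed by edges, columns indexed by vertices and edges. -/
noncomputable def totalMatrix {G : SimpleGraph V} (D : G.EdgeOrientation) :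
    Matrix G.edgeSet (V ⊕ G.edgeSet) ℝ :=
  Matrix.of fun e y =>
    if Touches e (D.head e) y then 1 else if Touches e (D.tail e) y then -1 else 0

/-- The matrix `B_G`: the submatrix of `A_G` on the columns indexed by edges. -/
noncomputable def edgeMatrix {G : SimpleGraph V} (D : G.EdgeOrientation) :
    Matrix G.edgeSet G.edgeSet ℝ :=
  (totalMatrix D).submatrix id Sum.inr

section Weighting

variable [Fintype V] [DecidableEq V] (G : SimpleGraph V) [DecidableRel G.Adj]

/-- The weight of `v` under the total weighting `f`: its own weight plus the weights of all edges
incident to it. -/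
noncomputable def vertexWeight (f : V ⊕ G.edgeSet → ℝ) (v : V) : ℝ :=
  f (Sum.inl v) +
    ∑ e ∈ Finset.univ.filter (fun e : G.edgeSet => v ∈ (e : Sym2 V)), f (Sum.inr e)

/-- A total weighting is proper if adjacent vertices have distinct weights. -/
def IsProperTotalWeighting (f : V ⊕ G.edgeSet → ℝ) : Prop :=
  ∀ u v : V, G.Adj u v → G.vertexWeight f u ≠ G.vertexWeight f v

/-- `G` is total weight `ψ`-choosable: for any assignment of lists of `ψ z` real numbers to
vertices and edges `z`, there is a proper total weighting with weights from the lists. -/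
def IsTotalWeightChoosable (ψ : V ⊕ G.edgeSet → ℕ) : Prop :=
  ∀ L : V ⊕ G.edgeSet → Finset ℝ, (∀ z, (L z).card = ψ z) →
    ∃ f : V ⊕ G.edgeSet → ℝ, (∀ z, f z ∈ L z) ∧ G.IsProperTotalWeighting f

/-- Total weight `(k, k')`-choosability: lists of size `k` on vertices and `k'` on edges. -/
def IsChoosable (k k' : ℕ) : Prop :=
  G.IsTotalWeightChoosable (Sum.elim (fun _ => k) (fun _ => k'))

/-- A bicyclic graph: connected with exactly one more edge than vertices. (Such a graph
automatically contains two or three cycles.) -/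
def IsBicyclic : Prop :=
  G.Connected ∧ G.edgeFinset.card = Fintype.card V + 1

end Weighting

end SimpleGraph

/-!
Let `P` be the product of the linear forms given by the rows of `edgeMatrix D`. A monomial of `P`
with nonzero coefficient and all exponents at most two bounds the permanent index by two and, by the
combinatorial Nullstellensatz, yields choosability. Such a monomial exists if `P` modulo 3 lies
outside the ideal `I` generated by the cubes of the variables.

Now `P` arises from the graph polynomial `g = ∏ (X u - X v)` by substituting for each `X v` the sum
of the variables of the edges at `v`. Cubing is additive in characteristic 3, so a further
substitution of linear forms in the vertices for the edge variables maps `I` into the corresponding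
ideal. If `G` is not bipartite, one can recover every `X v` in this way, and it suffices that `g`
lies outside `I`. If `G` is bipartite, the `X v` are recovered modulo the alternating sum `ℓ` of all
of them; as `ℓ ^ 3 ∈ I`, it suffices that `g * ℓ ^ 2` lies outside `I`.

Since `I` is stable under partial derivatives, a vertex of degree at most two can be removed by
differentiating with respect to its variable. This allows an induction over induced subgraphs, each
of which has at most one edge more than vertices; removing a vertex changes the linear factors, and
the point is to remove vertices in an order in which these factors do not vanish.
-/

namespace PermanentIndex

open Finset MvPolynomial SimpleGraph

section VarPowIdeal

variable {σ τ R : Type*} [CommRing R] {n p : ℕ}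

/-- The ideal generated by the `n`-th powers of the variables: a polynomial lies outside it exactly
when some monomial with all exponents below `n` occurs in it. -/
noncomputable def varPowIdeal (σ R : Type*) [CommRing R] (n : ℕ) : Ideal (MvPolynomial σ R) :=
  Ideal.span (Set.range fun i => X i ^ n)

lemma one_notMem_varPowIdeal [Nontrivial R] (hn : n ≠ 0) :
    (1 : MvPolynomial σ R) ∉ varPowIdeal σ R n := by
  have hker : varPowIdeal σ R n ≤ RingHom.ker (constantCoeff : MvPolynomial σ R →+* R) := by
    rw [varPowIdeal, Ideal.span_le]
    rintro _ ⟨i, rfl⟩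
    simp [RingHom.mem_ker, hn]
  exact fun h => by simpa [RingHom.mem_ker] using hker h

lemma exists_coeff_ne_zero_of_notMem_varPowIdeal {P : MvPolynomial σ R}
    (hP : P ∉ varPowIdeal σ R n) : ∃ k : σ →₀ ℕ, coeff k P ≠ 0 ∧ ∀ i, k i < n := by
  contrapose! hP
  rw [P.as_sum]
  refine Ideal.sum_mem _ fun k hk => ?_
  obtain ⟨i, hi⟩ := hP k (mem_support_iff.1 hk)
  have hdvd : monomial k (coeff k P) = monomial (k - Finsupp.single i n) (coeff k P) * X i ^ n := by
    rw [X_pow_eq_monomial, monomial_mul, mul_one,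
      tsub_add_cancel_of_le (Finsupp.single_le_iff.2 hi)]
  rw [hdvd]
  exact Ideal.mul_mem_left _ _ (Ideal.subset_span ⟨i, rfl⟩)

lemma aeval_mem_varPowIdeal {t : σ → MvPolynomial τ R} (ht : ∀ i, t i ^ n ∈ varPowIdeal τ R n)
    {P : MvPolynomial σ R} (hP : P ∈ varPowIdeal σ R n) : aeval t P ∈ varPowIdeal τ R n := by
  have hcomap : varPowIdeal σ R n ≤ (varPowIdeal τ R n).comap (aeval t) := by
    rw [varPowIdeal, Ideal.span_le]
    rintro _ ⟨i, rfl⟩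
    simpa using ht i
  exact hcomap hP

lemma pderiv_mem_varPowIdeal [CharP R p] (v : σ) {P : MvPolynomial σ R}
    (hP : P ∈ varPowIdeal σ R p) : pderiv v P ∈ varPowIdeal σ R p := by
  induction hP using Submodule.span_induction with
  | mem x hx =>
    obtain ⟨i, rfl⟩ := hx
    simp [Derivation.leibniz_pow]
  | zero => simp
  | add x y _ _ hx hy => simpa using Ideal.add_mem _ hx hy
  | smul a x hx hx' =>
    rw [smul_eq_mul, Derivation.leibniz]
    exact Ideal.add_mem _ (Ideal.mul_mem_left _ _ hx') (Ideal.mul_mem_right _ _ hx)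

lemma iterate_pderiv_mem_varPowIdeal [CharP R p] (v : σ) (k : ℕ) {P : MvPolynomial σ R}
    (hP : P ∈ varPowIdeal σ R p) : (pderiv v)^[k] P ∈ varPowIdeal σ R p := by
  induction k with
  | zero => exact hP
  | succ k ih => simpa only [Function.iterate_succ_apply'] using pderiv_mem_varPowIdeal v ih

end VarPowIdeal

section LinForm

variable {σ τ R : Type*} [Fintype σ] [CommRing R] {p : ℕ}

/-- The linear form `∑ i, c i • X i` with coefficient vector `c`. -/
noncomputable def linForm : (σ → R) →ₗ[R] MvPolynomial σ R := Fintype.linearCombination R X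

lemma linForm_apply (c : σ → R) : linForm c = ∑ i, C (c i) * X i := by
  simp [linForm, Fintype.linearCombination_apply, smul_eq_C_mul]

lemma linForm_single [DecidableEq σ] (i : σ) (r : R) : linForm (Pi.single i r) = C r * X i := by
  simp [linForm, smul_eq_C_mul]

lemma pderiv_linForm (v : σ) (c : σ → R) : pderiv v (linForm c) = C (c v) := by
  classical
  simp [linForm_apply, pderiv_X, Pi.single_apply]

lemma linForm_pow_mem_varPowIdeal [Fact p.Prime] [CharP R p] (c : σ → R) :
    linForm c ^ p ∈ varPowIdeal σ R p := by
  rw [linForm_apply, sum_pow_char p]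
  refine Ideal.sum_mem _ fun i _ => ?_
  rw [mul_pow]
  exact Ideal.mul_mem_left _ _ (Ideal.subset_span ⟨i, rfl⟩)

lemma isUnit_pderiv_linForm {F : Type*} [Field F] {v : σ} {c : σ → F} (hc : c v ≠ 0) :
    IsUnit (pderiv v (linForm c)) := by
  rw [pderiv_linForm]
  exact hc.isUnit.map C

lemma aeval_linForm {A : Type*} [CommRing A] [Algebra R A] (t : σ → A) (c : σ → R) :
    aeval t (linForm c) = ∑ i, c i • t i := by
  simp [linForm_apply, Algebra.smul_def]

end LinForm

section IteratedDerivative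

variable {σ F : Type*} [Field F] {p : ℕ} {v : σ}

lemma pderiv_eq_zero_of_isUnit {u : MvPolynomial σ F} (hu : IsUnit u) : pderiv v u = 0 := by
  obtain ⟨r, -, rfl⟩ := isUnit_iff_eq_C_of_isReduced.1 hu
  exact pderiv_C

lemma iterate_succ_pderiv_mul {R : Type*} [CommRing R] {L : MvPolynomial σ R}
    (hL : pderiv v (pderiv v L) = 0) (P : MvPolynomial σ R) (k : ℕ) :
    (pderiv v)^[k + 1] (L * P) =
      L * (pderiv v)^[k + 1] P + (k + 1) * (pderiv v L * (pderiv v)^[k] P) := by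
  induction k with
  | zero => simp [mul_comm]
  | succ k ih =>
    rw [Function.iterate_succ_apply', ih]
    simp only [map_add, Derivation.leibniz, smul_eq_mul, hL, Function.iterate_succ_apply',
      Derivation.map_natCast, Derivation.map_one_eq_zero]
    push_cast
    ring

lemma associated_iterate_pderiv_mul_prod [CharP F p] {q : MvPolynomial σ F}
    (hq : pderiv v q = 0) {M : Multiset (MvPolynomial σ F)} (hM : ∀ L ∈ M, IsUnit (pderiv v L))
    (hcard : M.card < p) : Associated ((pderiv v)^[M.card] (q * M.prod)) q := by
  induction M using Multiset.induction_on with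
  | empty => simp
  | cons L M ih =>
    rw [Multiset.card_cons] at hcard ⊢
    have hL : IsUnit (pderiv v L) := hM L (Multiset.mem_cons_self L M)
    have ih := ih (fun L' h => hM L' (Multiset.mem_cons_of_mem h)) (by lia)
    have hzero : (pderiv v)^[M.card + 1] (q * M.prod) = 0 := by
      obtain ⟨u, hu⟩ := ih.symm
      rw [Function.iterate_succ_apply', ← hu, Derivation.leibniz, hq,
        pderiv_eq_zero_of_isUnit u.isUnit]
      simp
    have hunit : IsUnit ((M.card + 1 : MvPolynomial σ F) * pderiv v L) := by
      refine IsUnit.mul ?_ hL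
      have : ((M.card + 1 : ℕ) : F) ≠ 0 := by
        rw [Ne, CharP.cast_eq_zero_iff F p]
        exact Nat.not_dvd_of_pos_of_lt M.card.succ_pos hcard
      simpa using this.isUnit.map (C : F →+* MvPolynomial σ F)
    rw [Multiset.prod_cons, mul_left_comm, iterate_succ_pderiv_mul (pderiv_eq_zero_of_isUnit hL),
      hzero, mul_zero, zero_add, ← mul_assoc]
    exact (associated_isUnit_mul_left_iff hunit).2 ih

end IteratedDerivative

section SecondDerivative

variable {σ R : Type*} [CommRing R] {v : σ} {r : R}

lemma pderiv_pderiv_mul_mul_mul {A B L g : MvPolynomial σ R}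
    (hA : pderiv v A = 1) (hB : pderiv v B = 1) (hL : pderiv v L = C r) (hg : pderiv v g = 0) :
    pderiv v (pderiv v (g * (A * B * L))) = 2 * (g * (L + C r * (A + B))) := by
  simp only [Derivation.leibniz, hL, smul_eq_mul, hB, mul_one, hA, hg, mul_zero, add_zero,
    map_add, derivation_C, zero_add]
  ring

lemma isUnit_two_of_char_three {R : Type*} [CommRing R] [CharP R 3] : IsUnit (2 : R) :=
  .of_mul_eq_one 2 (by linear_combination CharP.ofNat_eq_zero R 3)

variable [CharP R 3]

lemma pderiv_pderiv_mul_mul_sq {A B L g : MvPolynomial σ R}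
    (hA : pderiv v A = 1) (hB : pderiv v B = 1) (hL : pderiv v L = C r) (hg : pderiv v g = 0) :
    pderiv v (pderiv v (g * (A * B * L ^ 2))) =
      2 * (g * ((L - C r * A) * (L - C r * B))) := by
  simp only [pow_two, Derivation.leibniz, hL, smul_eq_mul, hB, mul_one, hA, hg, mul_zero, add_zero,
    map_add, derivation_C, zero_add]
  linear_combination (2 * g * L * C r * (A + B)) * CharP.ofNat_eq_zero (MvPolynomial σ R) 3

lemma pderiv_pderiv_mul_sq {A L g : MvPolynomial σ R}
    (hA : pderiv v A = 1) (hL : pderiv v L = C r) (hg : pderiv v g = 0) :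
    pderiv v (pderiv v (g * (A * L ^ 2))) = C r * (g * (L - C r * A)) := by
  simp only [pow_two, Derivation.leibniz, hL, smul_eq_mul, hA, mul_one, hg, mul_zero, add_zero,
    map_add, derivation_C, zero_add]
  linear_combination (g * C r * (L + C r * A)) * CharP.ofNat_eq_zero (MvPolynomial σ R) 3

end SecondDerivative

section InducedDegrees

variable {V : Type*} (G : SimpleGraph V) [DecidableRel G.Adj]

/-- The neighbours of `v` that lie in `K`. -/
def neighborsIn (K : Finset V) (v : V) : Finset V := K.filter (G.Adj v)

/-- The sum of the degrees of the subgraph induced on `K`, that is, twice its number of edges. -/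
def degSum (K : Finset V) : ℕ := ∑ v ∈ K, #(neighborsIn G K v)

/-- Every induced subgraph has at most one edge more than it has vertices. -/
def HasExcessLeOne : Prop := ∀ K : Finset V, degSum G K ≤ 2 * #K + 2

variable {G} {K : Finset V} {u v : V}

lemma mem_neighborsIn : u ∈ neighborsIn G K v ↔ u ∈ K ∧ G.Adj v u := mem_filter

lemma degSum_univ [Fintype V] : degSum G univ = 2 * #G.edgeFinset := by
  rw [← sum_degrees_eq_twice_card_edges, degSum]
  refine sum_congr rfl fun v _ => ?_
  rw [← card_neighborFinset_eq_degree, neighborsIn, neighborFinset_eq_filter]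

lemma card_neighborsIn_lt (hv : v ∈ K) : #(neighborsIn G K v) < #K :=
  card_lt_card <| filter_ssubset.2 ⟨v, hv, G.irrefl⟩

lemma neighborsIn_erase [DecidableEq V] :
    neighborsIn G (K.erase v) u = (neighborsIn G K u).erase v :=
  filter_erase ..

lemma card_neighborsIn_erase [DecidableEq V] (hv : v ∈ K) (h : G.Adj u v) :
    #(neighborsIn G (K.erase v) u) + 1 = #(neighborsIn G K u) := by
  rw [neighborsIn_erase, card_erase_add_one (mem_neighborsIn.2 ⟨hv, h⟩)]

lemma degSum_erase [DecidableEq V] (hv : v ∈ K) :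
    degSum G K = degSum G (K.erase v) + 2 * #(neighborsIn G K v) := by
  have hdeg : ∀ u ∈ K.erase v, #(neighborsIn G K u) =
      #(neighborsIn G (K.erase v) u) + if G.Adj v u then 1 else 0 := by
    intro u _
    split_ifs with h
    · rw [card_neighborsIn_erase hv h.symm]
    · rw [neighborsIn_erase, erase_eq_of_notMem fun hm => h (mem_neighborsIn.1 hm).2.symm,
        add_zero]
  have hsum : ∑ u ∈ K.erase v, (if G.Adj v u then 1 else 0) = #(neighborsIn G K v) := by
    rw [← card_filter, ← neighborsIn, neighborsIn_erase,
      erase_eq_of_notMem fun hm => (mem_neighborsIn.1 hm).2.ne rfl]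
  rw [degSum, ← add_sum_erase K _ hv, sum_congr rfl hdeg, sum_add_distrib, hsum, degSum]
  ring

lemma degSum_add_le_of_connected [Fintype V] (hG : G.Connected) (K : Finset V)
    (hK : K.Nonempty) : degSum G K + 2 * Fintype.card V ≤ degSum G univ + 2 * #K := by
  classical
  by_cases h : K = univ
  · rw [h, card_univ]
  · obtain ⟨x, hx⟩ := hK
    obtain ⟨y, hy⟩ : ∃ y, y ∉ K := by
      by_contra! hall
      exact h (eq_univ_iff_forall.2 hall)
    obtain ⟨d, -, hfst, hsnd⟩ := (hG.preconnected x y).some.exists_boundary_dart (K : Set V) hx hy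
    replace hsnd : d.snd ∉ K := hsnd
    have ih := degSum_add_le_of_connected hG _ (insert_nonempty d.snd K)
    rw [card_insert_of_notMem hsnd] at ih
    have herase := degSum_erase (G := G) (mem_insert_self d.snd K)
    rw [erase_insert hsnd] at herase
    have hpos : 0 < #(neighborsIn G (insert d.snd K) d.snd) :=
      card_pos.2 ⟨d.fst, mem_neighborsIn.2 ⟨mem_insert_of_mem hfst, d.adj.symm⟩⟩
    lia
termination_by Fintype.card V - #K
decreasing_by
  classical
  rw [card_insert_of_notMem hsnd]
  have := card_lt_univ_of_notMem hsnd
  lia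

lemma hasExcessLeOne_of_connected [Fintype V] (hG : G.Connected)
    (hE : #G.edgeFinset ≤ Fintype.card V + 1) : HasExcessLeOne G := by
  intro K
  rcases K.eq_empty_or_nonempty with rfl | hK
  · simp [degSum]
  · have := degSum_add_le_of_connected hG K hK
    rw [degSum_univ] at this
    lia

lemma exists_card_neighborsIn_le_two (hG : HasExcessLeOne G) (hK : K.Nonempty) :
    ∃ v ∈ K, #(neighborsIn G K v) ≤ 2 := by
  by_contra! h
  obtain ⟨v, hv⟩ := hK
  have hcard : 4 ≤ #K := Nat.lt_of_le_of_lt (h v hv) (card_neighborsIn_lt hv)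
  have hsum : #K • 3 ≤ degSum G K := card_nsmul_le_sum _ _ _ h
  have := hG K
  rw [smul_eq_mul] at hsum
  lia

lemma sum_card_neighborsIn_le (hG : HasExcessLeOne G) (hK : ∀ v ∈ K, 2 ≤ #(neighborsIn G K v))
    {T : Finset V} (hT : T ⊆ K) : ∑ v ∈ T, #(neighborsIn G K v) ≤ 2 * #T + 2 := by
  classical
  have hsum : degSum G K = ∑ v ∈ T, #(neighborsIn G K v) + ∑ v ∈ K \ T, #(neighborsIn G K v) := by
    rw [degSum, add_comm, sum_sdiff hT]
  have hrest : #(K \ T) • 2 ≤ ∑ v ∈ K \ T, #(neighborsIn G K v) :=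
    card_nsmul_le_sum _ _ _ fun v hv => hK v (sdiff_subset hv)
  have hcard : #(K \ T) + #T = #K := card_sdiff_add_card_eq_card hT
  have := hG K
  rw [smul_eq_mul] at hrest
  lia

lemma exists_ne_card_neighborsIn_eq_two (hG : HasExcessLeOne G)
    (hK : ∀ v ∈ K, 2 ≤ #(neighborsIn G K v)) (hv : v ∈ K) :
    ∃ u ∈ K, u ≠ v ∧ #(neighborsIn G K u) = 2 := by
  classical
  by_contra! h
  have hdeg : ∀ u ∈ K.erase v, 3 ≤ #(neighborsIn G K u) := by
    intro u hu
    obtain ⟨hne, hu⟩ := mem_erase.1 hu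
    exact (hK u hu).lt_of_ne (h u hu hne).symm
  have hsum := sum_card_neighborsIn_le hG hK (K.erase_subset v)
  have hthree : #(K.erase v) • 3 ≤ _ := card_nsmul_le_sum _ _ _ hdeg
  have hcard := card_erase_add_one hv
  have htwo := hK v hv
  have hlt := card_neighborsIn_lt (G := G) hv
  obtain ⟨u, hu⟩ : (K.erase v).Nonempty := card_pos.1 (by lia)
  have := hdeg u hu
  have := card_neighborsIn_lt (G := G) (mem_of_mem_erase hu)
  rw [smul_eq_mul] at hthree
  lia

lemma exists_eq_pair_of_card_eq_two {α : Type*} [DecidableEq α] {s : Finset α} {a : α}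
    (ha : a ∈ s) (hs : #s = 2) : ∃ b, b ≠ a ∧ s = {a, b} := by
  obtain ⟨b, hb⟩ := card_eq_one.1 (show #(s.erase a) = 1 by rw [card_erase_of_mem ha, hs])
  have hba : b ∈ s.erase a := by simp [hb]
  exact ⟨b, ne_of_mem_erase hba, by rw [← hb, insert_erase ha]⟩

/-- The subgraph induced on `K` is `K₂,₃` or `K₄` minus an edge. -/
lemma exists_twins [DecidableEq V] (hG : HasExcessLeOne G)
    (hK : ∀ v ∈ K, 2 ≤ #(neighborsIn G K v)) (hadj : ∀ v ∈ K, #(neighborsIn G K v) = 2 →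
      ∀ a ∈ neighborsIn G K v, #(neighborsIn G K a) ≠ 2) (hne : K.Nonempty) :
    ∃ v ∈ K, ∃ x ∈ K, x ≠ v ∧ ∃ a b, a ≠ b ∧ neighborsIn G K v = {a, b} ∧
      neighborsIn G K x = {a, b} ∧ #(neighborsIn G K a) = 3 ∧ #(neighborsIn G K b) = 3 := by
  obtain ⟨v, hv, hdegv⟩ := exists_card_neighborsIn_le_two hG hne
  replace hdegv := hdegv.antisymm (hK v hv)
  obtain ⟨a, b, hab, hNv⟩ := card_eq_two.1 hdegv
  have ha : a ∈ neighborsIn G K v := by simp [hNv]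
  have hb : b ∈ neighborsIn G K v := by simp [hNv]
  have haK := (mem_neighborsIn.1 ha).1
  have hbK := (mem_neighborsIn.1 hb).1
  have hthree : #(neighborsIn G K a) = 3 ∧ #(neighborsIn G K b) = 3 := by
    have hsum := sum_card_neighborsIn_le hG hK (insert_subset haK (singleton_subset_iff.2 hbK))
    rw [sum_pair hab, card_pair hab] at hsum
    have := hK a haK
    have := hK b hbK
    have := hadj v hv hdegv a ha
    have := hadj v hv hdegv b hb
    lia
  have htwo : ∀ y ∈ K, y ≠ a → y ≠ b → #(neighborsIn G K y) = 2 := by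
    intro y hy hya hyb
    have hsum := sum_card_neighborsIn_le hG hK
      (insert_subset hy (insert_subset haK (singleton_subset_iff.2 hbK)))
    rw [sum_insert (by simp [hya, hyb]), sum_pair hab,
      card_eq_three.2 ⟨y, a, b, hya, hyb, hab, rfl⟩] at hsum
    have := hK y hy
    lia
  obtain ⟨x, hxa, hx⟩ := exists_mem_notMem_of_card_lt_card
    (show #{v, b} < #(neighborsIn G K a) by rw [hthree.1]; exact card_le_two.trans_lt (by simp))
  simp only [mem_insert, mem_singleton, not_or] at hx
  obtain ⟨hxK, hax⟩ := mem_neighborsIn.1 hxa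
  have hdegx := htwo x hxK hax.ne' hx.2
  obtain ⟨y, hya, hNx⟩ := exists_eq_pair_of_card_eq_two
    (mem_neighborsIn.2 ⟨haK, hax.symm⟩) hdegx
  have hy : y ∈ neighborsIn G K x := by simp [hNx]
  obtain rfl : y = b := by
    by_contra hyb
    exact hadj x hxK hdegx y hy (htwo y (mem_neighborsIn.1 hy).1 hya hyb)
  exact ⟨v, hv, x, hxK, hx.1, a, y, hab, hNv, hNx, hthree⟩

end InducedDegrees

section GraphPoly

variable {V R F : Type*} {G : SimpleGraph V} [DecidableRel G.Adj] [CommRing R] [Field F] {p : ℕ}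
  {K : Finset V} {v : V}

lemma pderiv_X_sub_X {a : V} (h : a ∈ neighborsIn G K v) :
    pderiv v (X v - X a : MvPolynomial V R) = 1 := by
  simp [pderiv_X_of_ne (mem_neighborsIn.1 h).2.ne']

variable [Fintype V] [DecidableEq V]

/-- The edges of the subgraph induced on `K`. -/
def edgesIn (G : SimpleGraph V) [DecidableRel G.Adj] (K : Finset V) : Finset G.edgeSet :=
  univ.filter fun e => (e : Sym2 V) ∈ K.sym2

/-- The graph polynomial of the subgraph induced on `K`: the product of the differences
`X (head e) - X (tail e)` over its edges `e`. -/
noncomputable def graphPoly (R : Type*) [CommRing R] (D : G.EdgeOrientation) (K : Finset V) :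
    MvPolynomial V R :=
  ∏ e ∈ edgesIn G K, (X (D.head e) - X (D.tail e))

lemma graphPoly_empty (D : G.EdgeOrientation) : graphPoly R D ∅ = 1 := by
  simp [graphPoly, edgesIn]

lemma pderiv_graphPoly (D : G.EdgeOrientation) (hv : v ∉ K) :
    pderiv v (graphPoly R D K) = 0 := by
  refine prod_induction _ (fun P => pderiv v P = 0) ?_ pderiv_one fun e he => ?_
  · intro P Q hP hQ
    simp [Derivation.leibniz, hP, hQ]
  · rw [edgesIn, mem_filter, ← D.mk_tail_head, mk_mem_sym2_iff] at he
    rw [map_sub, pderiv_X_of_ne (ne_of_mem_of_not_mem he.2.2 hv),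
      pderiv_X_of_ne (ne_of_mem_of_not_mem he.2.1 hv), sub_zero]

lemma prod_edges_at {M : Type*} [CommMonoid M] (hv : v ∈ K) (f : G.edgeSet → M) :
    ∏ e ∈ edgesIn G K with v ∈ e.1, f e =
      ∏ a ∈ (neighborsIn G K v).attach, f ⟨s(v, a), (mem_neighborsIn.1 a.2).2⟩ := by
  symm
  refine prod_bij (fun a _ => ⟨s(v, a), (mem_neighborsIn.1 a.2).2⟩) ?_ ?_ ?_ fun _ _ => rfl
  · intro a _
    simp [edgesIn, hv, (mem_neighborsIn.1 a.2).1]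
  · intro a _ b _ hab
    exact Subtype.ext (Sym2.congr_right.1 (congrArg Subtype.val hab))
  · rintro ⟨e, hadj⟩ he
    obtain ⟨hK, a, rfl⟩ := mem_filter.1 he
    have haK := (mk_mem_sym2_iff.1 (mem_filter.1 hK).2).2
    exact ⟨⟨a, mem_neighborsIn.2 ⟨haK, hadj⟩⟩, mem_attach _ _, rfl⟩

lemma associated_graphPoly_erase (D : G.EdgeOrientation) (hv : v ∈ K) :
    Associated (graphPoly R D K)
      (graphPoly R D (K.erase v) * ∏ a ∈ neighborsIn G K v, (X v - X a)) := by
  have hout : graphPoly R D (K.erase v) =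
      ∏ e ∈ edgesIn G K with v ∉ e.1, (X (D.head e) - X (D.tail e)) := by
    rw [edgesIn, filter_filter]
    refine prod_congr (filter_congr fun e _ => ?_) fun _ _ => rfl
    simp only [mem_sym2_iff, mem_erase]
    exact ⟨fun h => ⟨fun a ha => (h a ha).2, fun hve => (h v hve).1 rfl⟩,
      fun h a ha => ⟨fun hav => h.2 (hav ▸ ha), h.1 a ha⟩⟩
  have hsplit : graphPoly R D K = graphPoly R D (K.erase v) *
      ∏ e ∈ edgesIn G K with v ∈ e.1, (X (D.head e) - X (D.tail e)) := by
    rw [hout, mul_comm, prod_filter_mul_prod_filter_not, graphPoly]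
  rw [hsplit, prod_edges_at hv, ← prod_attach (neighborsIn G K v)]
  refine (Associated.prod _ _ _ fun a _ => ?_).mul_left _
  obtain ⟨ht, hh⟩ | ⟨ht, hh⟩ :=
    Sym2.eq_iff.1 (D.mk_tail_head ⟨s(v, a), (mem_neighborsIn.1 a.2).2⟩)
  · rw [ht, hh, ← neg_sub (X v)]
    exact (Associated.refl _).neg_left
  · rw [ht, hh]
    exact Associated.refl _

/-- To remove `v` from `K`, differentiate with respect to `X v` until the linear factors of the
edges at `v` are gone. -/
lemma graphPoly_mul_notMem_of_iterate_pderiv [CharP F p] (D : G.EdgeOrientation) (hv : v ∈ K)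
    (k : ℕ) {P Q : MvPolynomial V F}
    (hPQ : Associated ((pderiv v)^[k]
      (graphPoly F D (K.erase v) * ((∏ a ∈ neighborsIn G K v, (X v - X a)) * P)))
      (graphPoly F D (K.erase v) * Q))
    (hQ : graphPoly F D (K.erase v) * Q ∉ varPowIdeal V F p) :
    graphPoly F D K * P ∉ varPowIdeal V F p := by
  rw [Ideal.mem_iff_of_associated ((associated_graphPoly_erase D hv).mul_right P), mul_assoc]
  exact fun h => hQ ((Ideal.mem_iff_of_associated hPQ).1 (iterate_pderiv_mem_varPowIdeal v k h))

lemma graphPoly_mul_prod_notMem [CharP F p] (D : G.EdgeOrientation) (hv : v ∈ K)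
    {q : MvPolynomial V F} (hq : pderiv v q = 0) {M : Multiset (MvPolynomial V F)}
    (hM : ∀ L ∈ M, IsUnit (pderiv v L)) (hcard : #(neighborsIn G K v) + M.card < p)
    (h : graphPoly F D (K.erase v) * q ∉ varPowIdeal V F p) :
    graphPoly F D K * (q * M.prod) ∉ varPowIdeal V F p := by
  set N := (neighborsIn G K v).val.map fun a => (X v - X a : MvPolynomial V F) with hN
  refine graphPoly_mul_notMem_of_iterate_pderiv D hv (M + N).card ?_ h
  have hprod : graphPoly F D (K.erase v) * ((∏ a ∈ neighborsIn G K v, (X v - X a)) *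
      (q * M.prod)) = graphPoly F D (K.erase v) * q * (M + N).prod := by
    rw [Multiset.prod_add, hN, ← prod_eq_multiset_prod]
    ring
  rw [hprod]
  refine associated_iterate_pderiv_mul_prod (p := p) ?_ ?_ ?_
  · simp [Derivation.leibniz, hq, pderiv_graphPoly D (notMem_erase v K)]
  · intro L hL
    obtain hL | hL := Multiset.mem_add.1 hL
    · exact hM L hL
    · obtain ⟨a, ha, rfl⟩ := Multiset.mem_map.1 hL
      simp [pderiv_X_of_ne (mem_neighborsIn.1 ha).2.ne']
  · rw [Multiset.card_add, hN, Multiset.card_map, card_val, add_comm]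
    exact hcard

lemma graphPoly_mul_notMem [CharP F p] (D : G.EdgeOrientation) (hv : v ∈ K)
    (hcard : #(neighborsIn G K v) < p) {q : MvPolynomial V F} (hq : pderiv v q = 0)
    (h : graphPoly F D (K.erase v) * q ∉ varPowIdeal V F p) :
    graphPoly F D K * q ∉ varPowIdeal V F p := by
  simpa using graphPoly_mul_prod_notMem D hv hq (M := 0) (by simp) (by simpa using hcard) h

lemma graphPoly_notMem [CharP F p] (hp : p ≠ 0) (D : G.EdgeOrientation)
    (hG : ∀ K : Finset V, K.Nonempty → ∃ v ∈ K, #(neighborsIn G K v) < p) (K : Finset V) :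
    graphPoly F D K ∉ varPowIdeal V F p := by
  induction K using Finset.strongInduction with
  | H K ih =>
    rcases K.eq_empty_or_nonempty with rfl | hK
    · rw [graphPoly_empty]
      exact one_notMem_varPowIdeal hp
    · obtain ⟨v, hv, hdeg⟩ := hG K hK
      simpa using graphPoly_mul_notMem D hv hdeg (q := 1) pderiv_one
        (by simpa using ih _ (erase_ssubset hv))

end GraphPoly

section Alternating

variable {V F : Type*} [Field F] {G : SimpleGraph V} {s : V → F} {a b : V}

/-- A nowhere zero weighting of the vertices that changes sign along every edge; it certifies that
`G` is bipartite. -/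
def IsAlternating (G : SimpleGraph V) (s : V → F) : Prop :=
  (∀ v, s v ≠ 0) ∧ ∀ u v, G.Adj u v → s u + s v = 0

lemma IsAlternating.sub_ne_zero [NeZero (2 : F)] (hs : IsAlternating G s) (h : G.Adj a b) :
    s a - s b ≠ 0 := fun h0 =>
  mul_ne_zero two_ne_zero (hs.1 a) (by linear_combination h0 + hs.2 a b h)

lemma IsAlternating.cliqueFree_three [NeZero (2 : F)] (hs : IsAlternating G s) :
    G.CliqueFree 3 := by
  classical
  intro T hT
  obtain ⟨x, y, z, hxy, hxz, hyz, -⟩ := is3Clique_iff.1 hT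
  exact hs.sub_ne_zero hxy (by linear_combination hs.2 x z hxz - hs.2 y z hyz)

end Alternating

section CharThree

variable {V F : Type*} [DecidableEq V] {G : SimpleGraph V} [DecidableRel G.Adj]
  [Field F] {K : Finset V} {v a b : V} {c s : V → F}

/-- The coefficient vector of the linear form that replaces `linForm c` when a vertex `v` with two
neighbours in `K` is removed: `c v` is subtracted on the closed neighbourhood of `v`. -/
def reduceAt (G : SimpleGraph V) [DecidableRel G.Adj] (K : Finset V) (v : V) (c : V → F) : V → F :=
  c - ∑ u ∈ insert v (neighborsIn G K v), Pi.single u (c v)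

/-- The vector obtained from `s` by moving the entry at `v` to `a`. -/
def moveEntry (v a : V) (s : V → F) : V → F := s - Pi.single v (s v) + Pi.single a (s v)

lemma reduceAt_apply (u : V) :
    reduceAt G K v c u = c u - if u ∈ insert v (neighborsIn G K v) then c v else 0 := by
  simp [reduceAt, Finset.sum_apply, Pi.single_apply]

lemma reduceAt_of_mem (h : a ∈ neighborsIn G K v) : reduceAt G K v c a = c a - c v := by
  rw [reduceAt_apply, if_pos (mem_insert_of_mem h)]

lemma moveEntry_target (h : a ≠ v) : moveEntry v a s a = s a + s v := by
  simp [moveEntry, h]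

lemma moveEntry_of_ne {u : V} (hv : u ≠ v) (ha : u ≠ a) : moveEntry v a s u = s u := by
  simp [moveEntry, hv, ha]

/-- If both reductions vanish, the support of `c` is the closed neighbourhood of `u` and that of
`v`, so `u` and `v` lie on a triangle. -/
lemma reduceAt_ne_zero_or_reduceAt_ne_zero (hT : G.CliqueFree 3) {u : V} (huv : u ≠ v)
    (hdegv : #(neighborsIn G K v) = 2) (hcu : c u ≠ 0) (hcv : c v ≠ 0) :
    reduceAt G K v c ≠ 0 ∨ reduceAt G K u c ≠ 0 := by
  by_contra! h
  have hsupp : ∀ {w x : V}, reduceAt G K w c = 0 → c w ≠ 0 →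
      (c x ≠ 0 ↔ x ∈ insert w (neighborsIn G K w)) := by
    intro w x hw hcw
    have hx := congrFun hw x
    rw [reduceAt_apply, Pi.zero_apply, sub_eq_zero] at hx
    rw [hx, ite_ne_right_iff, and_iff_left hcw]
  have huv' : u ∈ neighborsIn G K v := mem_of_mem_insert_of_ne ((hsupp h.1 hcv).1 hcu) huv
  obtain ⟨x, hx, hxu⟩ := exists_mem_ne (hdegv ▸ one_lt_two) u
  have hxu' : x ∈ neighborsIn G K u :=
    mem_of_mem_insert_of_ne ((hsupp h.2 hcu).1 ((hsupp h.1 hcv).2 (mem_insert_of_mem hx))) hxu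
  exact hT _ (is3Clique_triple_iff.2
    ⟨(mem_neighborsIn.1 huv').2, (mem_neighborsIn.1 hx).2, (mem_neighborsIn.1 hxu').2⟩)

variable [Fintype V]

lemma linForm_moveEntry :
    linForm (moveEntry v a s) = linForm s - C (s v) * (X v - X a) := by
  simp only [moveEntry, map_add, map_sub, linForm_single]
  ring

lemma linForm_reduceAt (hab : a ≠ b) (hN : neighborsIn G K v = {a, b}) :
    linForm (reduceAt G K v c) = linForm c - C (c v) * (X v + X a + X b) := by
  have hv : v ∉ ({a, b} : Finset V) := hN ▸ fun h => (mem_neighborsIn.1 h).2.ne rfl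
  rw [reduceAt, hN, sum_insert hv, sum_pair hab]
  simp only [map_sub, map_add, linForm_single]
  ring

variable [CharP F 3]

lemma graphPoly_mul_linForm_notMem_of_reduceAt (D : G.EdgeOrientation) (hv : v ∈ K)
    (hdeg : #(neighborsIn G K v) = 2) {q : MvPolynomial V F} (hq : pderiv v q = 0)
    (h : graphPoly F D (K.erase v) * (q * linForm (reduceAt G K v c)) ∉ varPowIdeal V F 3) :
    graphPoly F D K * (q * linForm c) ∉ varPowIdeal V F 3 := by
  obtain ⟨a, b, hab, hN⟩ := card_eq_two.1 hdeg
  refine graphPoly_mul_notMem_of_iterate_pderiv D hv 2 ?_ h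
  have hg : pderiv v (graphPoly F D (K.erase v) * q) = 0 := by
    simp [Derivation.leibniz, hq, pderiv_graphPoly D (notMem_erase v K)]
  have ha : a ∈ neighborsIn G K v := by simp [hN]
  have hb : b ∈ neighborsIn G K v := by simp [hN]
  have hderiv := pderiv_pderiv_mul_mul_mul (pderiv_X_sub_X ha) (pderiv_X_sub_X hb)
    (pderiv_linForm v c) hg
  have hreduce : linForm c + C (c v) * ((X v - X a) + (X v - X b)) =
      linForm (reduceAt G K v c) := by
    rw [linForm_reduceAt hab hN]
    linear_combination (C (c v) * X v) * CharP.ofNat_eq_zero (MvPolynomial V F) 3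
  change Associated (pderiv v (pderiv v _)) _
  rw [hN, prod_pair hab, mul_left_comm _ q, ← mul_assoc _ q, hderiv, hreduce, ← mul_assoc _ q]
  exact associated_unit_mul_left _ _ isUnit_two_of_char_three

lemma graphPoly_mul_linForm_sq_notMem_of_pair (D : G.EdgeOrientation) (hv : v ∈ K) (hab : a ≠ b)
    (hN : neighborsIn G K v = {a, b})
    (h : graphPoly F D (K.erase v) * (linForm (moveEntry v a s) * linForm (moveEntry v b s)) ∉
      varPowIdeal V F 3) :
    graphPoly F D K * linForm s ^ 2 ∉ varPowIdeal V F 3 := by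
  refine graphPoly_mul_notMem_of_iterate_pderiv D hv 2 ?_ h
  have ha : a ∈ neighborsIn G K v := by simp [hN]
  have hb : b ∈ neighborsIn G K v := by simp [hN]
  have hderiv := pderiv_pderiv_mul_mul_sq (pderiv_X_sub_X ha) (pderiv_X_sub_X hb)
    (pderiv_linForm v s) (pderiv_graphPoly D (notMem_erase v K))
  rw [← linForm_moveEntry, ← linForm_moveEntry] at hderiv
  change Associated (pderiv v (pderiv v _)) _
  rw [hN, prod_pair hab, hderiv]
  exact associated_unit_mul_left _ _ isUnit_two_of_char_three

lemma graphPoly_mul_linForm_sq_notMem_of_singleton (D : G.EdgeOrientation) (hv : v ∈ K)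
    (hN : neighborsIn G K v = {a}) (hs : s v ≠ 0)
    (h : graphPoly F D (K.erase v) * linForm (moveEntry v a s) ∉ varPowIdeal V F 3) :
    graphPoly F D K * linForm s ^ 2 ∉ varPowIdeal V F 3 := by
  refine graphPoly_mul_notMem_of_iterate_pderiv D hv 2 ?_ h
  have ha : a ∈ neighborsIn G K v := by simp [hN]
  have hderiv := pderiv_pderiv_mul_sq (pderiv_X_sub_X ha) (pderiv_linForm v s)
    (pderiv_graphPoly D (notMem_erase v K))
  rw [← linForm_moveEntry] at hderiv
  change Associated (pderiv v (pderiv v _)) _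
  rw [hN, prod_singleton, hderiv]
  exact associated_unit_mul_left _ _ (hs.isUnit.map C)

lemma graphPoly_notMem_of_hasExcessLeOne (hG : HasExcessLeOne G) (D : G.EdgeOrientation)
    (K : Finset V) : graphPoly F D K ∉ varPowIdeal V F 3 :=
  graphPoly_notMem three_ne_zero D (fun _ hK =>
    (exists_card_neighborsIn_le_two hG hK).imp fun _ => And.imp_right Nat.lt_succ_of_le) K

lemma graphPoly_mul_linForm_notMem_of_card_le_one (hG : HasExcessLeOne G) (D : G.EdgeOrientation)
    (hc : c v ≠ 0) (hv : v ∈ K → #(neighborsIn G K v) ≤ 1) :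
    graphPoly F D K * linForm c ∉ varPowIdeal V F 3 := by
  by_cases hvK : v ∈ K
  · have hcard : #(neighborsIn G K v) + Multiset.card {linForm c} < 3 := by
      rw [Multiset.card_singleton]
      have := hv hvK
      lia
    simpa using graphPoly_mul_prod_notMem D hvK (q := 1) pderiv_one
      (M := {linForm c}) (by simpa using isUnit_pderiv_linForm hc) hcard
      (by simpa using graphPoly_notMem_of_hasExcessLeOne hG D (K.erase v))
  · intro hmem
    have hderiv : pderiv v (graphPoly F D K * linForm c) = C (c v) * graphPoly F D K := by
      simp [Derivation.leibniz, pderiv_graphPoly D hvK, pderiv_linForm, mul_comm]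
    refine graphPoly_notMem_of_hasExcessLeOne hG D K ((Ideal.mem_iff_of_associated ?_).1
      (hderiv ▸ pderiv_mem_varPowIdeal v hmem))
    exact associated_unit_mul_left _ _ (hc.isUnit.map C)

theorem graphPoly_mul_linForm_notMem (hG : HasExcessLeOne G) (hT : G.CliqueFree 3)
    (D : G.EdgeOrientation) (K : Finset V) (hc : c ≠ 0) :
    graphPoly F D K * linForm c ∉ varPowIdeal V F 3 := by
  induction K using Finset.strongInduction generalizing c with
  | H K ih =>
    by_cases hlow : ∃ v, c v ≠ 0 ∧ (v ∈ K → #(neighborsIn G K v) ≤ 1)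
    · obtain ⟨v, hcv, hv⟩ := hlow
      exact graphPoly_mul_linForm_notMem_of_card_le_one hG D hcv hv
    by_cases hzero : ∃ v ∈ K, #(neighborsIn G K v) ≤ 2 ∧ c v = 0
    · obtain ⟨v, hv, hdeg, hcv⟩ := hzero
      refine graphPoly_mul_notMem D hv (Nat.lt_succ_of_le hdeg) ?_ (ih _ (erase_ssubset hv) hc)
      rw [pderiv_linForm, hcv, C_0]
    push Not at hlow hzero
    have hmin : ∀ v ∈ K, 2 ≤ #(neighborsIn G K v) := by
      intro v hv
      by_contra! hlt
      exact (hlow v (hzero v hv (by lia))).2.not_ge (by lia)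
    obtain ⟨x, hcx⟩ := Function.ne_iff.1 hc
    obtain ⟨v, hv, -, hdegv⟩ := exists_ne_card_neighborsIn_eq_two hG hmin (hlow x hcx).1
    obtain ⟨u, hu, huv, hdegu⟩ := exists_ne_card_neighborsIn_eq_two hG hmin hv
    have hreduce : ∀ w ∈ K, #(neighborsIn G K w) = 2 → reduceAt G K w c ≠ 0 →
        graphPoly F D K * linForm c ∉ varPowIdeal V F 3 := by
      intro w hw hdegw hne
      simpa using graphPoly_mul_linForm_notMem_of_reduceAt D hw hdegw (q := 1) pderiv_one
        (by simpa using ih _ (erase_ssubset hw) hne)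
    obtain hne | hne := reduceAt_ne_zero_or_reduceAt_ne_zero hT huv hdegv
      (hzero u hu hdegu.le) (hzero v hv hdegv.le)
    exacts [hreduce v hv hdegv hne, hreduce u hu hdegu hne]

lemma graphPoly_mul_linForm_sq_notMem_of_leaf (hG : HasExcessLeOne G) (hT : G.CliqueFree 3)
    (D : G.EdgeOrientation) (hV : Fintype.card V ≠ 2) (hs : ∀ u, s u ≠ 0) (hv : v ∈ K)
    (hN : neighborsIn G K v = {a}) : graphPoly F D K * linForm s ^ 2 ∉ varPowIdeal V F 3 := by
  refine graphPoly_mul_linForm_sq_notMem_of_singleton D hv hN (hs v)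
    (graphPoly_mul_linForm_notMem hG hT D _ ?_)
  obtain ⟨u, hu⟩ : ∃ u, u ∉ ({v, a} : Finset V) := by
    by_contra! hall
    have ha : a ∈ neighborsIn G K v := by simp [hN]
    rw [← card_univ, ← eq_univ_iff_forall.2 hall, card_pair (mem_neighborsIn.1 ha).2.ne] at hV
    exact hV rfl
  simp only [mem_insert, mem_singleton, not_or] at hu
  refine Function.ne_iff.2 ⟨u, ?_⟩
  rw [moveEntry_of_ne hu.1 hu.2]
  exact hs u

lemma graphPoly_mul_linForm_sq_notMem_of_adjacent (hG : HasExcessLeOne G) (hT : G.CliqueFree 3)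
    (D : G.EdgeOrientation) (hs : IsAlternating G s) (hv : v ∈ K) (hab : a ≠ b)
    (hN : neighborsIn G K v = {a, b}) (ha : #(neighborsIn G K a) = 2) :
    graphPoly F D K * linForm s ^ 2 ∉ varPowIdeal V F 3 := by
  obtain ⟨haK, hva⟩ := mem_neighborsIn.1 (show a ∈ neighborsIn G K v by simp [hN])
  obtain ⟨-, hvb⟩ := mem_neighborsIn.1 (show b ∈ neighborsIn G K v by simp [hN])
  have hcoeff_a : moveEntry v a s a = 0 := by
    rw [moveEntry_target hva.ne', hs.2 a v hva.symm]
  have hcoeff_b : moveEntry v b s a ≠ 0 := by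
    rw [moveEntry_of_ne hva.ne' hab]
    exact hs.1 a
  have hne : moveEntry v a s ≠ 0 := by
    refine Function.ne_iff.2 ⟨b, ?_⟩
    rw [moveEntry_of_ne hvb.ne' hab.symm]
    exact hs.1 b
  have hcard := card_neighborsIn_erase hv hva.symm
  have hrest := graphPoly_mul_prod_notMem D (mem_erase.2 ⟨hva.ne', haK⟩)
    (q := linForm (moveEntry v a s)) (by rw [pderiv_linForm, hcoeff_a, C_0])
    (M := {linForm (moveEntry v b s)}) (by simpa using isUnit_pderiv_linForm hcoeff_b)
    (by rw [Multiset.card_singleton]; lia) (graphPoly_mul_linForm_notMem hG hT D _ hne)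
  exact graphPoly_mul_linForm_sq_notMem_of_pair D hv hab hN (by simpa using hrest)

lemma graphPoly_mul_linForm_mul_linForm_notMem (hG : HasExcessLeOne G) (D : G.EdgeOrientation)
    {x : V} {d : V → F} (hx : x ∈ K) (ha : a ∈ K) (hb : b ∈ K) (hab : a ≠ b)
    (hnadj : ¬ G.Adj a b) (hN : neighborsIn G K x = {a, b}) (hdega : #(neighborsIn G K a) = 2)
    (hdegb : #(neighborsIn G K b) = 2) (hca : c a = 0) (hdb : d b = 0) (hcx : c x - c b ≠ 0)
    (hdx : d x - d a ≠ 0) :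
    graphPoly F D K * (linForm c * linForm d) ∉ varPowIdeal V F 3 := by
  have hxa := (mem_neighborsIn.1 (show a ∈ neighborsIn G K x by simp [hN])).2
  have hxb := (mem_neighborsIn.1 (show b ∈ neighborsIn G K x by simp [hN])).2
  have hdegb' : #(neighborsIn G (K.erase a) b) = 2 := by
    rwa [neighborsIn_erase, erase_eq_of_notMem fun h => hnadj (mem_neighborsIn.1 h).2.symm]
  have hisolated : neighborsIn G ((K.erase a).erase b) x = ∅ := by
    rw [neighborsIn_erase, neighborsIn_erase, hN, erase_insert (by simpa using hab),
      ← insert_empty_eq, erase_insert (notMem_empty b)]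
  have hd_b : reduceAt G K a d b = 0 := by
    simp [reduceAt_apply, mem_neighborsIn, hnadj, hab.symm, hdb]
  have hd_x : reduceAt G K a d x ≠ 0 := by
    rwa [reduceAt_of_mem (mem_neighborsIn.2 ⟨hx, hxa.symm⟩)]
  have hc_x : reduceAt G (K.erase a) b c x ≠ 0 := by
    rwa [reduceAt_of_mem (mem_neighborsIn.2 ⟨mem_erase.2 ⟨hxa.ne, hx⟩, hxb.symm⟩)]
  have hlast := graphPoly_mul_prod_notMem (K := (K.erase a).erase b) D (v := x)
    (by simp [hx, hxa.ne, hxb.ne]) (q := 1) pderiv_one (p := 3)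
    (M := {linForm (reduceAt G K a d), linForm (reduceAt G (K.erase a) b c)})
    (by simpa using ⟨isUnit_pderiv_linForm hd_x, isUnit_pderiv_linForm hc_x⟩)
    (by simp [hisolated]) (by simpa using graphPoly_notMem_of_hasExcessLeOne hG D _)
  have hdrop_b := graphPoly_mul_linForm_notMem_of_reduceAt D (mem_erase.2 ⟨hab.symm, hb⟩) hdegb'
    (q := linForm (reduceAt G K a d)) (by rw [pderiv_linForm, hd_b, C_0]) (by simpa using hlast)
  refine graphPoly_mul_linForm_notMem_of_reduceAt D ha hdega
    (by rw [pderiv_linForm, hca, C_0]) ?_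
  rwa [mul_comm (linForm c)]

lemma graphPoly_mul_linForm_sq_notMem_of_twins (hG : HasExcessLeOne G) (hT : G.CliqueFree 3)
    (D : G.EdgeOrientation) (hs : IsAlternating G s) {x : V} (hv : v ∈ K) (hx : x ∈ K)
    (hxv : x ≠ v) (hab : a ≠ b) (hNv : neighborsIn G K v = {a, b})
    (hNx : neighborsIn G K x = {a, b}) (ha : #(neighborsIn G K a) = 3)
    (hb : #(neighborsIn G K b) = 3) : graphPoly F D K * linForm s ^ 2 ∉ varPowIdeal V F 3 := by
  have : NeZero (2 : F) := ⟨isUnit_two_of_char_three.ne_zero⟩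
  obtain ⟨haK, hva⟩ := mem_neighborsIn.1 (show a ∈ neighborsIn G K v by simp [hNv])
  obtain ⟨hbK, hvb⟩ := mem_neighborsIn.1 (show b ∈ neighborsIn G K v by simp [hNv])
  have hxa := (mem_neighborsIn.1 (show a ∈ neighborsIn G K x by simp [hNx])).2
  have hxb := (mem_neighborsIn.1 (show b ∈ neighborsIn G K x by simp [hNx])).2
  have hcard_a := card_neighborsIn_erase hv hva.symm
  have hcard_b := card_neighborsIn_erase hv hvb.symm
  refine graphPoly_mul_linForm_sq_notMem_of_pair D hv hab hNv
    (graphPoly_mul_linForm_mul_linForm_notMem hG D (x := x) (mem_erase.2 ⟨hxv, hx⟩)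
      (mem_erase.2 ⟨hva.ne', haK⟩) (mem_erase.2 ⟨hvb.ne', hbK⟩) hab
      (fun h => hT _ (is3Clique_triple_iff.2 ⟨hva, hvb, h⟩)) ?_ (by lia) (by lia) ?_ ?_ ?_ ?_)
  · rw [neighborsIn_erase, hNx, erase_eq_of_notMem (by simp [hva.ne, hvb.ne])]
  · rw [moveEntry_target hva.ne', hs.2 a v hva.symm]
  · rw [moveEntry_target hvb.ne', hs.2 b v hvb.symm]
  · rw [moveEntry_of_ne hxv hxa.ne, moveEntry_of_ne hvb.ne' hab.symm]
    exact hs.sub_ne_zero hxb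
  · rw [moveEntry_of_ne hxv hxb.ne, moveEntry_of_ne hva.ne' hab]
    exact hs.sub_ne_zero hxa

theorem graphPoly_mul_linForm_sq_notMem (hG : HasExcessLeOne G) (D : G.EdgeOrientation)
    (hV : Fintype.card V ≠ 2) (hs : IsAlternating G s) (hK : K.Nonempty) :
    graphPoly F D K * linForm s ^ 2 ∉ varPowIdeal V F 3 := by
  have : NeZero (2 : F) := ⟨isUnit_two_of_char_three.ne_zero⟩
  have hT := hs.cliqueFree_three
  by_cases hzero : ∃ v ∈ K, #(neighborsIn G K v) = 0
  · obtain ⟨v, hv, hdeg⟩ := hzero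
    have hL := isUnit_pderiv_linForm (hs.1 v)
    simpa [pow_two] using graphPoly_mul_prod_notMem D hv (q := 1) pderiv_one (p := 3)
      (M := {linForm s, linForm s}) (by simpa using hL) (by simp [hdeg])
      (by simpa using graphPoly_notMem_of_hasExcessLeOne hG D (K.erase v))
  by_cases hleaf : ∃ v ∈ K, #(neighborsIn G K v) = 1
  · obtain ⟨v, hv, hdeg⟩ := hleaf
    obtain ⟨a, hN⟩ := card_eq_one.1 hdeg
    exact graphPoly_mul_linForm_sq_notMem_of_leaf hG hT D hV hs.1 hv hN
  have hmin : ∀ v ∈ K, 2 ≤ #(neighborsIn G K v) := by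
    intro v hv
    by_contra! hlt
    obtain h | h := Nat.le_one_iff_eq_zero_or_eq_one.1 (Nat.le_of_lt_succ hlt)
    exacts [hzero ⟨v, hv, h⟩, hleaf ⟨v, hv, h⟩]
  by_cases hadj : ∃ v ∈ K, #(neighborsIn G K v) = 2 ∧
      ∃ a ∈ neighborsIn G K v, #(neighborsIn G K a) = 2
  · obtain ⟨v, hv, hdeg, a, ha, hdega⟩ := hadj
    obtain ⟨b, hba, hN⟩ := exists_eq_pair_of_card_eq_two ha hdeg
    exact graphPoly_mul_linForm_sq_notMem_of_adjacent hG hT D hs hv hba.symm hN hdega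
  push Not at hadj
  obtain ⟨v, hv, x, hx, hxv, a, b, hab, hNv, hNx, ha, hb⟩ := exists_twins hG hmin hadj hK
  exact graphPoly_mul_linForm_sq_notMem_of_twins hG hT D hs hv hx hxv hab hNv hNx ha hb

end CharThree

section Permanent

variable {m n R : Type*} [Fintype n] [CommRing R] {k : n →₀ ℕ}

lemma linForm_isHomogeneous (c : n → R) : (linForm c).IsHomogeneous 1 := by
  rw [linForm_apply]
  exact .sum _ _ _ fun _ _ => isHomogeneous_C_mul_X _ _

lemma prod_linForm_isHomogeneous (A : Matrix m n R) (t : Finset m) :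
    (∏ i ∈ t, linForm (A i)).IsHomogeneous #t := by
  simpa using IsHomogeneous.prod t _ (fun _ => 1) fun i _ => linForm_isHomogeneous (A i)

variable [Fintype m]

/-- The product of the linear forms whose coefficient vectors are the rows of `A`. -/
noncomputable def rowProd (A : Matrix m n R) : MvPolynomial n R := ∏ i, linForm (A i)

lemma map_rowProd {S : Type*} [CommRing S] (f : R →+* S) (A : Matrix m n R) :
    MvPolynomial.map f (rowProd A) = rowProd (A.map f) := by
  simp [rowProd, linForm_apply]

lemma coeff_prod_linForm_add_C (A : Matrix m n R) (b : m → R)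
    (hk : k.degree = Fintype.card m) :
    coeff k (∏ i, (linForm (A i) + C (b i))) = coeff k (rowProd A) := by
  classical
  rw [prod_add, coeff_sum, sum_eq_single univ]
  · simp [rowProd]
  · intro t _ ht
    have hhom := (prod_linForm_isHomogeneous A t).mul (isHomogeneous_C n (∏ i ∈ univ \ t, b i))
    rw [map_prod, add_zero] at hhom
    refine hhom.coeff_eq_zero ?_
    rw [hk]
    exact ((card_lt_iff_ne_univ t).2 ht).ne'
  · simp

/-- Apply the combinatorial Nullstellensatz to `∏ i, (linForm (A i) + C (b i))`, whose leading form
is `rowProd A`. -/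
lemma exists_forall_mulVec_add_ne_zero [IsDomain R] {A : Matrix m n R}
    (h : coeff k (rowProd A) ≠ 0) (b : m → R) (L : n → Finset R) (hL : ∀ j, k j < #(L j)) :
    ∃ x : n → R, (∀ j, x j ∈ L j) ∧ ∀ i, A.mulVec x i + b i ≠ 0 := by
  have hk : k.degree = Fintype.card m := by
    by_contra hne
    exact h ((prod_linForm_isHomogeneous A univ).coeff_eq_zero hne)
  rw [← coeff_prod_linForm_add_C A b hk] at h
  have hdeg : (∏ i, (linForm (A i) + C (b i))).totalDegree = k.degree := by
    refine le_antisymm ?_ (le_totalDegree (mem_support_iff.2 h))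
    rw [hk, ← card_univ, card_eq_sum_ones]
    refine (totalDegree_finsetProd _ _).trans (sum_le_sum fun i _ => ?_)
    refine (totalDegree_add _ _).trans (max_le (linForm_isHomogeneous (A i)).totalDegree_le ?_)
    rw [totalDegree_C]
    exact zero_le_one
  obtain ⟨x, hx, hne⟩ := combinatorial_nullstellensatz_exists_eval_nonzero _ k h hdeg L hL
  rw [map_prod, prod_ne_zero_iff] at hne
  refine ⟨x, hx, fun i => ?_⟩
  simpa [linForm_apply, Matrix.mulVec, dotProduct] using hne i (mem_univ i)

variable [DecidableEq m]

lemma sum_monomial_permanent (A : Matrix m n R) :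
    ∑ f : m → n, monomial (∑ i, Finsupp.single (f i) 1) (A.submatrix id f).permanent =
      (Fintype.card m).factorial • rowProd A := by
  have hexpand (f : m → n) :
      monomial (∑ i, Finsupp.single (f i) 1) (A.submatrix id f).permanent =
        ∑ σ : Equiv.Perm m, ∏ i, (C (A (σ i) (f i)) * X (f i) : MvPolynomial n R) := by
    rw [Matrix.permanent, map_sum]
    refine sum_congr rfl fun σ _ => ?_
    simp only [C_mul_X_eq_monomial, Matrix.submatrix_apply, id_eq]
    rw [monomial_sum_prod]
  have hrow (σ : Equiv.Perm m) :
      ∑ f : m → n, ∏ i, (C (A (σ i) (f i)) * X (f i) : MvPolynomial n R) = rowProd A := by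
    rw [rowProd, ← Equiv.prod_comp σ]
    simp only [linForm_apply]
    rw [prod_univ_sum, Fintype.piFinset_univ]
  rw [sum_congr rfl fun f _ => hexpand f, sum_comm, sum_congr rfl fun σ _ => hrow σ, sum_const,
    card_univ, Fintype.card_perm]

variable [DecidableEq n] {A : Matrix m n ℝ} {d : ℕ}

lemma hasNonzeroPermSelection_of_coeff_rowProd_ne_zero (h : coeff k (rowProd A) ≠ 0)
    (hk : ∀ j, k j ≤ d) : A.HasNonzeroPermSelection d := by
  have hcoeff := congrArg (coeff k) (sum_monomial_permanent A)
  rw [coeff_sum, coeff_smul] at hcoeff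
  obtain ⟨f, -, hf⟩ := exists_ne_zero_of_sum_ne_zero
    (hcoeff ▸ smul_ne_zero (Nat.factorial_ne_zero _) h)
  rw [coeff_monomial] at hf
  obtain ⟨rfl, hperm⟩ := ite_ne_right_iff.1 hf
  refine ⟨f, fun j => ?_, hperm⟩
  simpa [Finsupp.finsetSum_apply, Finsupp.single_apply] using hk j

lemma pind_le_of_coeff_rowProd_ne_zero (h : coeff k (rowProd A) ≠ 0) (hk : ∀ j, k j ≤ d) :
    A.pind ≤ d :=
  iInf₂_le d (hasNonzeroPermSelection_of_coeff_rowProd_ne_zero h hk)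

end Permanent

section Incidence

variable {V : Type*} [DecidableEq V] {G : SimpleGraph V}

/-- The matrix whose row `e` is the incidence vector of the head of `e` minus that of its tail; this
is `edgeMatrix D` over an arbitrary ring. -/
def incidenceDiff (R : Type*) [CommRing R] (D : G.EdgeOrientation) : Matrix G.edgeSet G.edgeSet R :=
  Matrix.of fun e y => (if D.head e ∈ y.1 then 1 else 0) - if D.tail e ∈ y.1 then 1 else 0

lemma edgeMatrix_eq_incidenceDiff (D : G.EdgeOrientation) :
    edgeMatrix D = incidenceDiff ℝ D := by
  ext e y
  have hhead : D.head e ∈ e.1 := by rw [← D.mk_tail_head]; exact Sym2.mem_mk_right _ _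
  have htail : D.tail e ∈ e.1 := by rw [← D.mk_tail_head]; exact Sym2.mem_mk_left _ _
  have hadj : G.Adj (D.tail e) (D.head e) := by
    rw [← mem_edgeSet, D.mk_tail_head]
    exact e.2
  simp only [edgeMatrix, totalMatrix, Matrix.submatrix_apply, id_eq, Matrix.of_apply, Touches,
    incidenceDiff]
  by_cases hye : y = e
  · simp [hye, hhead, htail]
  · have hnot : ¬ (D.tail e ∈ y.1 ∧ D.head e ∈ y.1) := fun h =>
      hye (Subtype.ext (((Sym2.mem_and_mem_iff hadj.ne).1 h).trans (D.mk_tail_head e)))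
    by_cases hh : D.head e ∈ y.1 <;> by_cases ht : D.tail e ∈ y.1
    · exact absurd ⟨ht, hh⟩ hnot
    all_goals simp [hye, hh, ht]

lemma map_incidenceDiff {R S : Type*} [CommRing R] [CommRing S] (f : R →+* S)
    (D : G.EdgeOrientation) : (incidenceDiff R D).map f = incidenceDiff S D := by
  ext e y
  simp [incidenceDiff, apply_ite f]

variable [Fintype V] [DecidableRel G.Adj]

/-- The map sending a weighting of the edges to the sums of the weights at each vertex. -/
def incidentSum (G : SimpleGraph V) [DecidableRel G.Adj] (R A : Type*) [CommRing R]
    [AddCommMonoid A] [Module R A] : (G.edgeSet → A) →ₗ[R] V → A where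
  toFun w v := ∑ e : G.edgeSet with v ∈ e.1, w e
  map_add' w w' := by ext v; simp [sum_add_distrib]
  map_smul' c w := by ext v; simp [smul_sum]

variable {R F : Type*} [CommRing R] [Field F] {p : ℕ}

lemma sum_incidenceDiff_smul {A : Type*} [AddCommGroup A] [Module R A] (D : G.EdgeOrientation)
    (t : G.edgeSet → A) (e : G.edgeSet) :
    ∑ y, incidenceDiff R D e y • t y =
      incidentSum G R A t (D.head e) - incidentSum G R A t (D.tail e) := by
  simp [incidenceDiff, incidentSum, sub_smul, sum_filter, ite_smul]

lemma aeval_rowProd_incidenceDiff {A : Type*} [CommRing A] [Algebra R A] (D : G.EdgeOrientation)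
    (t : G.edgeSet → A) :
    aeval t (rowProd (incidenceDiff R D)) = aeval (incidentSum G R A t) (graphPoly R D univ) := by
  simp only [rowProd, graphPoly, edgesIn, map_prod, aeval_linForm, sum_incidenceDiff_smul, map_sub,
    aeval_X, sym2_univ, mem_univ, filter_true]

lemma incidentSum_linForm (w : V → G.edgeSet → R) (u : V) :
    incidentSum G R (MvPolynomial V R) (fun e => linForm fun v => w v e) u =
      linForm fun v => incidentSum G R R (w v) u := by
  change ∑ e : G.edgeSet with u ∈ e.1, linForm (fun v => w v e) = _
  rw [← map_sum]
  congr 1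
  ext v
  simp [incidentSum]

lemma aeval_graphPoly_mem_varPowIdeal [Fact p.Prime] [CharP R p] (D : G.EdgeOrientation)
    (h : rowProd (incidenceDiff R D) ∈ varPowIdeal G.edgeSet R p) {b : V → V → R}
    (hb : ∀ v, b v ∈ LinearMap.range (incidentSum G R R)) :
    aeval (fun u => linForm fun v => b v u) (graphPoly R D univ) ∈ varPowIdeal V R p := by
  choose w hw using hb
  have hmem := aeval_mem_varPowIdeal (t := fun e => linForm fun v => w v e)
    (fun e => linForm_pow_mem_varPowIdeal _) h
  rw [aeval_rowProd_incidenceDiff] at hmem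
  simpa only [funext (incidentSum_linForm w), hw] using hmem

lemma single_add_single_mem_range {u v : V} (h : G.Adj u v) :
    Pi.single u 1 + Pi.single v 1 ∈ LinearMap.range (incidentSum G R R) := by
  refine ⟨Pi.single ⟨s(u, v), h⟩ 1, ?_⟩
  ext x
  have hne := h.ne
  simp only [incidentSum, LinearMap.coe_mk, AddHom.coe_mk, Pi.add_apply, Pi.single_apply,
    sum_ite_eq', mem_filter, mem_univ, true_and, Sym2.mem_iff]
  by_cases hx : x = u
  · simp [hx, hne]
  · simp [hx]

lemma exists_single_add_smul_single_mem_range {u v : V} (walk : G.Walk u v) :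
    ∃ c : F, c ≠ 0 ∧
      Pi.single u 1 + c • Pi.single v 1 ∈ LinearMap.range (incidentSum G F F) := by
  induction walk with
  | nil => exact ⟨-1, by simp, by simp⟩
  | cons h _ ih =>
    obtain ⟨c, hc, hmem⟩ := ih
    refine ⟨-c, neg_ne_zero.2 hc, ?_⟩
    convert sub_mem (single_add_single_mem_range h) hmem using 1
    module

lemma forall_single_mem_range_or_exists_isAlternating (hG : G.Connected) :
    (∀ v, Pi.single v 1 ∈ LinearMap.range (incidentSum G F F)) ∨
      ∃ (q : V) (s : V → F), IsAlternating G s ∧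
        ∀ v, Pi.single v 1 + s v • Pi.single q 1 ∈ LinearMap.range (incidentSum G F F) := by
  obtain ⟨q⟩ := hG.nonempty
  choose s hs0 hs using fun v =>
    exists_single_add_smul_single_mem_range (F := F) (hG.preconnected v q).some
  by_cases hq : Pi.single q 1 ∈ LinearMap.range (incidentSum G F F)
  · refine .inl fun v => ?_
    simpa using sub_mem (hs v) (Submodule.smul_mem _ (s v) hq)
  · refine .inr ⟨q, s, ⟨hs0, fun u v huv => ?_⟩, hs⟩
    by_contra hne
    have hmem := sub_mem (add_mem (hs u) (hs v)) (single_add_single_mem_range huv)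
    rw [show (Pi.single u 1 + s u • Pi.single q 1 + (Pi.single v 1 + s v • Pi.single q 1) -
      (Pi.single u 1 + Pi.single v 1) : V → F) = (s u + s v) • Pi.single q 1 by module] at hmem
    exact hq ((Submodule.smul_mem_iff _ hne).1 hmem)

lemma aeval_sub_self_mem {σ : Type*} {I : Ideal (MvPolynomial σ R)} {t : σ → MvPolynomial σ R}
    (ht : ∀ i, t i - X i ∈ I) (P : MvPolynomial σ R) : aeval t P - P ∈ I := by
  have hext : (Ideal.Quotient.mkₐ R I).comp (aeval t) = Ideal.Quotient.mkₐ R I :=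
    algHom_ext fun i => by simpa using Ideal.Quotient.eq.2 (ht i)
  exact Ideal.Quotient.eq.1 (DFunLike.congr_fun hext P)

/-- Modulo `linForm s` the substitution `t` is the identity, and `linForm s ^ p` lies in the
ideal. -/
lemma mul_linForm_pow_mem_varPowIdeal {σ : Type*} [Fintype σ] [Fact p.Prime] [CharP R p]
    {s : σ → R} {t : σ → MvPolynomial σ R} (ht : ∀ i, linForm s ∣ t i - X i)
    {P : MvPolynomial σ R} (hP : aeval t P ∈ varPowIdeal σ R p) :
    P * linForm s ^ (p - 1) ∈ varPowIdeal σ R p := by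
  obtain ⟨Q, hQ⟩ := Ideal.mem_span_singleton.1
    (aeval_sub_self_mem (fun i => Ideal.mem_span_singleton.2 (ht i)) P)
  have hpow := pow_sub_one_mul (Fact.out : p.Prime).ne_zero (linForm s)
  have hsplit : P * linForm s ^ (p - 1) = aeval t P * linForm s ^ (p - 1) - linForm s ^ p * Q := by
    linear_combination -Q * hpow - linForm s ^ (p - 1) * hQ
  rw [hsplit]
  exact sub_mem (Ideal.mul_mem_right _ _ hP)
    (Ideal.mul_mem_right _ _ (linForm_pow_mem_varPowIdeal s))

lemma rowProd_incidenceDiff_notMem [CharP F 3] (hG : G.Connected) (hV : Fintype.card V ≠ 2)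
    (hE : #G.edgeFinset ≤ Fintype.card V + 1) (D : G.EdgeOrientation) :
    rowProd (incidenceDiff F D) ∉ varPowIdeal G.edgeSet F 3 := by
  have hexc := hasExcessLeOne_of_connected hG hE
  have : Fact (Nat.Prime 3) := ⟨Nat.prime_three⟩
  intro hmem
  obtain hall | ⟨q, s, hs, hmod⟩ := forall_single_mem_range_or_exists_isAlternating (F := F) hG
  · have hX := aeval_graphPoly_mem_varPowIdeal D hmem hall
    simp only [← Pi.single_comm, linForm_single, C_1, one_mul, aeval_X_left_apply] at hX
    exact graphPoly_notMem_of_hasExcessLeOne hexc D univ hX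
  · have hY := aeval_graphPoly_mem_varPowIdeal D hmem hmod
    refine graphPoly_mul_linForm_sq_notMem hexc D hV hs (univ_nonempty_iff.2 hG.nonempty)
      (mul_linForm_pow_mem_varPowIdeal (fun u => ⟨C ((Pi.single q 1 : V → F) u), ?_⟩) hY)
    have hvec : (fun v => (Pi.single v 1 + s v • Pi.single q 1 : V → F) u) =
        Pi.single u 1 + (Pi.single q 1 : V → F) u • s := by
      ext v
      simp [Pi.single_comm v, mul_comm]
    rw [hvec, map_add, map_smul, linForm_single, C_1, one_mul, smul_eq_C_mul,
      add_sub_cancel_left, mul_comm]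

omit [DecidableEq V] in
lemma exists_coeff_rowProd_edgeMatrix_ne_zero (hG : G.Connected) (hV : Fintype.card V ≠ 2)
    (hE : #G.edgeFinset ≤ Fintype.card V + 1) (D : G.EdgeOrientation) :
    ∃ k : G.edgeSet →₀ ℕ, coeff k (rowProd (edgeMatrix D)) ≠ 0 ∧ ∀ e, k e < 3 := by
  classical
  obtain ⟨k, hk, hlt⟩ := exists_coeff_ne_zero_of_notMem_varPowIdeal
    (rowProd_incidenceDiff_notMem (F := ZMod 3) hG hV hE D)
  refine ⟨k, fun hzero => hk ?_, hlt⟩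
  rw [edgeMatrix_eq_incidenceDiff, ← map_incidenceDiff (Int.castRingHom ℝ), ← map_rowProd,
    coeff_map, eq_intCast, Int.cast_eq_zero] at hzero
  rw [← map_incidenceDiff (Int.castRingHom (ZMod 3)), ← map_rowProd, coeff_map, hzero, map_zero]

lemma vertexWeight_sumElim (a : V → ℝ) (x : G.edgeSet → ℝ) (v : V) :
    G.vertexWeight (Sum.elim a x) v = a v + incidentSum G ℝ ℝ x v := rfl

lemma nonempty_edgeOrientation {V : Type*} (G : SimpleGraph V) : Nonempty G.EdgeOrientation :=
  ⟨⟨fun e => e.1.out.1, fun e => e.1.out.2, fun e => Quot.out_eq e.1⟩⟩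

lemma isProperTotalWeighting_of_forall_edge (D : G.EdgeOrientation) {f : V ⊕ G.edgeSet → ℝ}
    (h : ∀ e, G.vertexWeight f (D.head e) ≠ G.vertexWeight f (D.tail e)) :
    G.IsProperTotalWeighting f := by
  intro u v huv
  have hne := h ⟨s(u, v), huv⟩
  obtain ⟨ht, hh⟩ | ⟨ht, hh⟩ := Sym2.eq_iff.1 (D.mk_tail_head ⟨s(u, v), huv⟩)
  · rw [ht, hh] at hne
    exact hne.symm
  · rwa [ht, hh] at hne

lemma isChoosable_one_of_coeff_rowProd_ne_zero (D : G.EdgeOrientation) {k : G.edgeSet →₀ ℕ} {d : ℕ}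
    (hk : coeff k (rowProd (edgeMatrix D)) ≠ 0) (hd : ∀ e, k e < d) : G.IsChoosable 1 d := by
  intro L hL
  choose a ha using fun v => card_pos.1 (one_pos.trans_eq (hL (Sum.inl v)).symm)
  obtain ⟨x, hx, hne⟩ := exists_forall_mulVec_add_ne_zero hk
    (fun e => a (D.head e) - a (D.tail e)) (fun e => L (Sum.inr e))
    fun e => (hd e).trans_eq (hL (Sum.inr e)).symm
  refine ⟨Sum.elim a x, Sum.rec ha hx, isProperTotalWeighting_of_forall_edge D fun e heq => ?_⟩
  rw [vertexWeight_sumElim, vertexWeight_sumElim] at heq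
  apply hne e
  have hsum := sum_incidenceDiff_smul (R := ℝ) D x e
  rw [← edgeMatrix_eq_incidenceDiff] at hsum
  change ∑ y, edgeMatrix D e y • x y + _ = 0
  linear_combination hsum + heq

end Incidence

end PermanentIndex

open PermanentIndex in
theorem theorem3p4_general {V : Type*} [Fintype V] [DecidableEq V] (G : SimpleGraph V)
    [DecidableRel G.Adj] (hG : G.Connected) (hV : Fintype.card V ≠ 2)
    (hE : G.edgeFinset.card ≤ Fintype.card V + 1) :
    (∀ D : G.EdgeOrientation, (SimpleGraph.edgeMatrix D).pind ≤ 2) ∧ G.IsChoosable 1 3 := by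
  have hcoeff := exists_coeff_rowProd_edgeMatrix_ne_zero hG hV hE
  constructor
  · intro D
    obtain ⟨k, hk, hlt⟩ := hcoeff D
    exact pind_le_of_coeff_rowProd_ne_zero hk fun e => Nat.le_of_lt_succ (hlt e)
  · obtain ⟨D⟩ := nonempty_edgeOrientation G
    obtain ⟨k, hk, hlt⟩ := hcoeff D
    exact isChoosable_one_of_coeff_rowProd_ne_zero D hk hlt

theorem theorem3p4 {V : Type*} [Fintype V] [DecidableEq V] (B : SimpleGraph V)
    [DecidableRel B.Adj] (hB : B.IsBicyclic) :
    (∀ D : B.EdgeOrientation, (SimpleGraph.edgeMatrix D).pind ≤ 2) ∧ B.IsChoosable 1 3 := by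
  refine theorem3p4_general B hB.1 (fun hV => ?_) hB.2.le
  simpa [hB.2, hV] using B.card_edgeFinset_le_card_choose_two
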